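/- Let $n$ be a natural number, let $\alpha>0$, and let $f:\mathbb C^n\to\mathbb C$ be entire. For $0<p\le\infty$ let $L^p_\alpha$ be the space of Lebesgue measurable functions $g$ on $\mathbb C^n$ such that $g(z)e^{-\alpha|z|^2/2}$ belongs to $L^p(\mathbb C^n,dv)$, where $dv$ is ordinary volume measure and $|z|$ is the Euclidean norm, and let $F^p_\alpha$ be the space of entire functions on $\mathbb C^n$ that belong to $L^p_\alpha$. Let $Rf(z)=\sum_{k=1}^n z_k\,\frac{\partial f}{\partial z_k}(z)$ be the radial derivative of $f$. - (a) If $0<p\le\infty$ and $f\in F^p_\alpha$, then the function $z\mapsto Rf(z)/(1+|z|^2)$ belongs to $L^p_\alpha$. - (b) If $p=1$ or $p=\infty$, and the function $z\mapsto Rf(z)/(1+|z|^2)$ belongs to $L^p_\alpha$, then $f\in F^p_\alpha$. -/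

import Mathlib

open MeasureTheory
open scoped ENNReal

noncomputable section

/-- The weighted space `L^p_α(ℂⁿ)`: the (almost everywhere) Lebesgue measurable `g : ℂⁿ → ℂ` such
that `g(z) e^{-α|z|²/2}` belongs to `L^p(ℂⁿ, dv)`, where `dv` is ordinary volume measure on
`ℂⁿ` and `|z|` is the Euclidean norm. -/
def weightedLp (n : ℕ) (α : ℝ) (p : ℝ≥0∞) : Set (EuclideanSpace ℂ (Fin n) → ℂ) :=
  {g | MemLp (fun z => g z * (Real.exp (-α * ‖z‖ ^ 2 / 2) : ℂ)) p volume}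

/-- The space `H(ℂⁿ)` of entire functions. -/
def entireFunctions (n : ℕ) : Set (EuclideanSpace ℂ (Fin n) → ℂ) :=
  {f | Differentiable ℂ f}

/-- The Fock space `F^p_α = L^p_α ∩ H(ℂⁿ)`. -/
def fockSpace (n : ℕ) (α : ℝ) (p : ℝ≥0∞) : Set (EuclideanSpace ℂ (Fin n) → ℂ) :=
  weightedLp n α p ∩ entireFunctions n

/-- The complex partial derivative `∂_k f(z) = ∂f/∂z_k`. -/
def partialDeriv {n : ℕ} (k : Fin n) (f : EuclideanSpace ℂ (Fin n) → ℂ)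
    (z : EuclideanSpace ℂ (Fin n)) : ℂ :=
  lineDeriv ℂ f z (EuclideanSpace.single k 1)

/-- The radial derivative `Rf(z) = z₁ ∂₁f(z) + ⋯ + zₙ ∂ₙf(z)`. -/
def radialDeriv {n : ℕ} (f : EuclideanSpace ℂ (Fin n) → ℂ)
    (z : EuclideanSpace ℂ (Fin n)) : ℂ :=
  ∑ k, z k * partialDeriv k f z

end

/-! (a) `Rf(z)` is the derivative at `l = 0` of `f(z + l z)`. Cauchy's estimate on `|l| = (1+|z|)⁻²`
moves `z` by less than 1 and changes `|z|²` by at most 3, so the Gaussian weight varies by a bounded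
factor (`exists_radialDeriv_le`). This settles `p = ∞`. For `p < ∞` a sub-mean value inequality for
the weighted `|f|^p` replaces the point value by an average over a ball of fixed radius, and Tonelli
finishes.

(b) `f` is recovered by integrating `Rf(tz)/t` along rays. For `p = ∞` the integrand is dominated by
the derivative of a multiple of `exp(α t²|z|²/2)`. For `p = 1`, Tonelli and the dilation `w = z/s`
move the integral onto `|Rf(w)|`, and a Gaussian tail in `s` supplies both the weight at `w` and the
factor `1/|w|²` (`lintegral_pow_mul_gaussian_le`). -/

/-! ### Radial derivative and Cauchy estimate -/

theorem radialDeriv_eq_fderiv {n : ℕ} {f : EuclideanSpace ℂ (Fin n) → ℂ}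
    {z : EuclideanSpace ℂ (Fin n)} (hf : DifferentiableAt ℂ f z) :
    radialDeriv f z = fderiv ℂ f z z := by
  have hz : z = ∑ k, z k • EuclideanSpace.single k (1 : ℂ) := by
    ext i
    simp [Finset.sum_apply, Pi.single_apply]
  have h2 := congrArg (fderiv ℂ f z) hz
  simp only [map_sum, map_smul, smul_eq_mul] at h2
  rw [h2]
  simp only [radialDeriv, partialDeriv, hf.lineDeriv_eq_fderiv]

theorem radialDeriv_eq_deriv {n : ℕ} {f : EuclideanSpace ℂ (Fin n) → ℂ}
    {z : EuclideanSpace ℂ (Fin n)} (hf : DifferentiableAt ℂ f z) :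
    radialDeriv f z = deriv (fun l : ℂ => f (z + l • z)) 0 := by
  rw [radialDeriv_eq_fderiv hf, ← hf.lineDeriv_eq_fderiv]
  rfl

/-- Cauchy's formula on the unit circle in `l` turns the derivative into an integral of a jointly
continuous integrand. -/
theorem continuous_radialDeriv {n : ℕ} {f : EuclideanSpace ℂ (Fin n) → ℂ}
    (hf : Differentiable ℂ f) : Continuous (radialDeriv f) := by
  have h : radialDeriv f = fun z => Complex.cderiv 1 (fun l : ℂ => f (z + l • z)) 0 := by
    ext z
    rw [radialDeriv_eq_deriv (hf z)]
    symm
    apply Complex.cderiv_eq_deriv isOpen_univ _ one_pos (Set.subset_univ _)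
    exact Differentiable.differentiableOn (by fun_prop)
  have hc := hf.continuous
  suffices key : Continuous (Function.uncurry fun (z : EuclideanSpace ℂ (Fin n)) (θ : ℝ) =>
      deriv (circleMap 0 1) θ • ((circleMap 0 1 θ - 0) ^ 2)⁻¹ • f (z + circleMap 0 1 θ • z)) by
    rw [h]
    have h2 := intervalIntegral.continuous_parametric_intervalIntegral_of_continuous'
      (μ := volume) key 0 (2 * Real.pi)
    exact h2.const_smul ((2 * Real.pi * Complex.I : ℂ)⁻¹)
  simp only [Function.uncurry_def, sub_zero, deriv_circleMap]
  have h1 : Continuous fun x : ℝ => circleMap 0 1 x := continuous_circleMap 0 1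
  have h2 : Continuous fun x : ℝ => ((circleMap 0 1 x) ^ 2)⁻¹ :=
    (h1.pow 2).inv₀ fun x => pow_ne_zero _ (circleMap_ne_center one_ne_zero)
  have h1' : Continuous fun x : EuclideanSpace ℂ (Fin n) × ℝ => circleMap 0 1 x.2 :=
    h1.comp continuous_snd
  have h2' : Continuous fun x : EuclideanSpace ℂ (Fin n) × ℝ => ((circleMap 0 1 x.2) ^ 2)⁻¹ :=
    h2.comp continuous_snd
  refine Continuous.smul (h1'.mul continuous_const) (h2'.smul (hc.comp ?_))
  exact continuous_fst.add (h1'.smul continuous_fst)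

theorem exists_radialDeriv_le {n : ℕ} {f : EuclideanSpace ℂ (Fin n) → ℂ}
    (hf : Differentiable ℂ f) {α : ℝ} (hα : 0 < α) (z : EuclideanSpace ℂ (Fin n)) :
    ∃ w, ‖w - z‖ ≤ 1 ∧ ‖radialDeriv f z‖ / (1 + ‖z‖ ^ 2) * Real.exp (-α * ‖z‖ ^ 2 / 2) ≤
      2 * Real.exp (3 * α / 2) * (‖f w‖ * Real.exp (-α * ‖w‖ ^ 2 / 2)) := by
  have hc := hf.continuous
  obtain ⟨w, hw, hmax⟩ := (isCompact_closedBall z 1).exists_isMaxOn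
    ⟨z, Metric.mem_closedBall_self zero_le_one⟩
    (f := fun w => ‖f w‖ * Real.exp (-α * ‖w‖ ^ 2 / 2)) (by fun_prop)
  refine ⟨w, by simpa [dist_eq_norm] using hw, ?_⟩
  set A := ‖f w‖ * Real.exp (-α * ‖w‖ ^ 2 / 2)
  have hA : 0 ≤ A := by positivity
  set x := ‖z‖
  have hx : 0 ≤ x := norm_nonneg z
  -- With this radius `‖l • z‖ ≤ 1/(1+x)`; in `‖z + l • z‖²` the cross term costs at most 2 and the
  -- square at most 1, whence the 3.
  have key : ‖deriv (fun l : ℂ => f (z + l • z)) 0‖ ≤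
      (A * Real.exp (α * (x ^ 2 + 3) / 2)) / (1 / (1 + x) ^ 2) := by
    apply Complex.norm_deriv_le_of_forall_mem_sphere_norm_le (by positivity)
    · exact Differentiable.diffContOnCl (by fun_prop)
    · intro l hl
      have hl' : ‖l‖ = 1 / (1 + x) ^ 2 := by simpa using hl
      have hlx : ‖l • z‖ = x / (1 + x) ^ 2 := by rw [norm_smul, hl']; simp only [x]; ring
      have hb : x / (1 + x) ^ 2 ≤ 1 / (1 + x) := by
        rw [div_le_div_iff₀ (by positivity) (by positivity)]; nlinarith
      have hb1 : 1 / (1 + x) ≤ 1 := by rw [div_le_one (by positivity)]; linarith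
      have hb2 : x * (1 / (1 + x)) ≤ 1 := by
        rw [mul_one_div, div_le_one (by positivity)]; linarith
      have hm := hmax (a := z + l • z) (by
        simp only [Metric.mem_closedBall, dist_eq_norm, add_sub_cancel_left, hlx]; linarith)
      simp only [Set.mem_ofPred_eq] at hm
      have hn : ‖z + l • z‖ ^ 2 ≤ x ^ 2 + 3 := by
        have h1 : ‖z + l • z‖ ≤ x + 1 / (1 + x) := (norm_add_le _ _).trans (by rw [hlx]; gcongr)
        have h0 := norm_nonneg (z + l • z)
        have h4 : 0 ≤ 1 / (1 + x) := by positivity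
        nlinarith
      calc ‖f (z + l • z)‖ = ‖f (z + l • z)‖ * Real.exp (-α * ‖z + l • z‖ ^ 2 / 2) *
            Real.exp (α * ‖z + l • z‖ ^ 2 / 2) := by
            rw [mul_assoc, ← Real.exp_add]; ring_nf; simp
        _ ≤ A * Real.exp (α * (x ^ 2 + 3) / 2) := by gcongr
  rw [← radialDeriv_eq_deriv (hf z)] at key
  have h2 : (1 + x) ^ 2 ≤ 2 * (1 + x ^ 2) := by nlinarith [sq_nonneg (1 - x)]
  rw [div_mul_eq_mul_div, div_le_iff₀ (by positivity)]
  calc ‖radialDeriv f z‖ * Real.exp (-α * x ^ 2 / 2)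
      ≤ A * Real.exp (α * (x ^ 2 + 3) / 2) / (1 / (1 + x) ^ 2) * Real.exp (-α * x ^ 2 / 2) := by
        gcongr
    _ = A * Real.exp (3 * α / 2) * (1 + x) ^ 2 := by
        have : Real.exp (α * (x ^ 2 + 3) / 2) * Real.exp (-α * x ^ 2 / 2) =
            Real.exp (3 * α / 2) := by rw [← Real.exp_add]; ring_nf
        rw [← this]; field_simp
    _ ≤ A * Real.exp (3 * α / 2) * (2 * (1 + x ^ 2)) := by gcongr
    _ = _ := by ring

/-! ### Sub-mean value inequalities -/

/-- A sub-mean value inequality for `|g|^p`, up to a constant, valid for all `0 < p < ∞`. -/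
theorem exists_enorm_rpow_le_lintegral_ball {E : Type*} [NormedAddCommGroup E] [NormedSpace ℂ E]
    [NormedSpace ℝ E] [MeasurableSpace E] [BorelSpace E] [FiniteDimensional ℝ E]
    (μ : Measure E) [μ.IsAddHaarMeasure] {p : ℝ} (hp : 0 < p) :
    ∃ C : ℝ≥0∞, C ≠ ∞ ∧ ∀ g : E → ℂ, Differentiable ℂ g →
      ‖g 0‖ₑ ^ p ≤ C * ∫⁻ u in Metric.ball 0 1, ‖g u‖ₑ ^ p ∂μ := by
  have : ProperSpace E := FiniteDimensional.proper ℝ E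
  set d := Module.finrank ℝ E
  -- Chosen so that `(2δ)^(m p) = (2δ)^(d+1) ≤ (2δ)^d`, matching the volume of a ball of radius
  -- comparable to `δ`; the `+ 1` keeps `m` positive when `d = 0`.
  set m : ℝ := (d + 1) / p
  have hm : 0 < m := by positivity
  set K : ℝ := 2 ^ m + 1
  have hK : 1 < K := by have := Real.rpow_pos_of_pos two_pos m; linarith
  set V := μ (Metric.ball 0 1)
  have hV0 : V ≠ 0 := (Metric.measure_ball_pos μ _ one_pos).ne'
  have hVt : V ≠ ∞ := measure_ball_lt_top.ne
  refine ⟨ENNReal.ofReal (2 ^ p * (4 * K) ^ d) * V⁻¹, by finiteness, fun g hg => ?_⟩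
  have hgc := hg.continuous
  by_cases hg0 : g 0 = 0
  · simp [hg0, hp]
  -- At a maximum of this product, `‖g‖ ≤ 2^m ‖g w‖` on the ball of radius `δ` about `w`. The
  -- Schwarz lemma then keeps `‖g‖ ≥ ‖g w‖ / 2` on the smaller radius `r`.
  obtain ⟨w, hw, hmax⟩ := (isCompact_closedBall (0 : E) 1).exists_isMaxOn
    ⟨0, Metric.mem_closedBall_self zero_le_one⟩
    (f := fun w => ‖g w‖ * (1 - ‖w‖) ^ m) (by fun_prop (disch := positivity))
  have hle : ∀ u : E, ‖u‖ ≤ 1 → ‖g u‖ * (1 - ‖u‖) ^ m ≤ ‖g w‖ * (1 - ‖w‖) ^ m := fun u hu =>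
    hmax (a := u) (by simpa using hu)
  have hw1 : ‖w‖ ≤ 1 := by simpa using hw
  have h0 : ‖g 0‖ ≤ ‖g w‖ * (1 - ‖w‖) ^ m := by simpa using hle 0 (by simp)
  have hpos : 0 < ‖g 0‖ := norm_pos_iff.2 hg0
  have hw2 : ‖w‖ < 1 := by
    rcases hw1.lt_or_eq with h | h
    · exact h
    · rw [h, sub_self, Real.zero_rpow hm.ne', mul_zero] at h0; linarith
  have hgw : 0 < ‖g w‖ := by
    rcases (norm_nonneg (g w)).lt_or_eq with h | h
    · exact h
    · rw [← h, zero_mul] at h0; linarith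
  set δ := (1 - ‖w‖) / 2
  have hδ : 0 < δ := by simp only [δ]; linarith
  have hwδ : 1 - ‖w‖ = 2 * δ := by simp only [δ]; ring
  set r := δ / (2 * K)
  have hr : 0 < r := by positivity
  have hrδ : r ≤ δ := div_le_self hδ.le (by linarith)
  have hlow : ∀ u ∈ Metric.ball w r, ‖g w‖ / 2 ≤ ‖g u‖ := by
    intro u hu
    have hs := Complex.dist_le_div_mul_dist_of_mapsTo_ball (f := g) (c := w) (z := u) (R₁ := δ)
      (R₂ := K * ‖g w‖) hg.differentiableOn (fun v hv => by
        rw [Metric.mem_ball, dist_eq_norm] at hv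
        have hv1 : ‖v‖ ≤ ‖w‖ + ‖v - w‖ := by simpa using norm_add_le w (v - w)
        have hv2 : δ ≤ 1 - ‖v‖ := by linarith
        have h1 := hle v (by linarith)
        rw [hwδ, Real.mul_rpow two_pos.le hδ.le] at h1
        have h2 : δ ^ m ≤ (1 - ‖v‖) ^ m := Real.rpow_le_rpow hδ.le hv2 hm.le
        have h3 : ‖g v‖ * δ ^ m ≤ (‖g w‖ * 2 ^ m) * δ ^ m :=
          (mul_le_mul_of_nonneg_left h2 (norm_nonneg _)).trans (by rwa [mul_assoc])
        have h4 := le_of_mul_le_mul_right h3 (by positivity)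
        rw [Metric.mem_closedBall, dist_eq_norm]
        calc _ ≤ ‖g v‖ + ‖g w‖ := norm_sub_le _ _
          _ ≤ ‖g w‖ * 2 ^ m + ‖g w‖ := by gcongr
          _ = K * ‖g w‖ := by simp only [K]; ring) (Metric.ball_subset_ball hrδ hu)
    have h1 : K * ‖g w‖ / δ * dist u w ≤ K * ‖g w‖ / δ * r := by
      gcongr; exact (Metric.mem_ball.1 hu).le
    have h2 : K * ‖g w‖ / δ * r = ‖g w‖ / 2 := by simp only [r]; field_simp
    rw [dist_eq_norm, ← norm_neg, neg_sub] at hs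
    have h3 := norm_sub_norm_le (g w) (g u)
    linarith
  have hsub : Metric.ball w r ⊆ Metric.ball 0 1 := by
    intro u hu
    rw [Metric.mem_ball, dist_eq_norm] at hu
    have hv1 : ‖u‖ ≤ ‖w‖ + ‖u - w‖ := by simpa using norm_add_le w (u - w)
    rw [mem_ball_zero_iff]; linarith
  have hint : ENNReal.ofReal ((‖g w‖ / 2) ^ p * r ^ d) * V ≤
      ∫⁻ u in Metric.ball 0 1, ‖g u‖ₑ ^ p ∂μ := by
    calc ENNReal.ofReal ((‖g w‖ / 2) ^ p * r ^ d) * V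
        = ∫⁻ _ in Metric.ball w r, ENNReal.ofReal ((‖g w‖ / 2) ^ p) ∂μ := by
          rw [setLIntegral_const, Measure.addHaar_ball_of_pos μ w hr,
            ENNReal.ofReal_mul (by positivity), mul_assoc]
      _ ≤ ∫⁻ u in Metric.ball w r, ‖g u‖ₑ ^ p ∂μ := by
          refine setLIntegral_mono' measurableSet_ball fun u hu => ?_
          rw [← ENNReal.ofReal_rpow_of_nonneg (by positivity) hp.le, ← ofReal_norm]
          gcongr
          exact hlow u hu
      _ ≤ _ := lintegral_mono_set hsub
  have hnum : ‖g 0‖ ^ p ≤ 2 ^ p * (4 * K) ^ d * ((‖g w‖ / 2) ^ p * r ^ d) := by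
    calc ‖g 0‖ ^ p ≤ (‖g w‖ * (2 * δ) ^ m) ^ p := by
          rw [hwδ] at h0; gcongr
      _ = ‖g w‖ ^ p * (2 * δ) ^ (d + 1) := by
          rw [Real.mul_rpow hgw.le (by positivity), ← Real.rpow_mul (by positivity)]
          congr 1
          rw [← Real.rpow_natCast]
          congr 1
          simp only [m]; push_cast; field_simp
      _ ≤ ‖g w‖ ^ p * (2 * δ) ^ d := by
          gcongr ?_ * ?_
          have : 2 * δ ≤ 1 := by rw [← hwδ]; linarith [norm_nonneg w]
          exact pow_le_pow_of_le_one (by positivity) this (Nat.le_succ d)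
      _ = 2 ^ p * (4 * K) ^ d * ((‖g w‖ / 2) ^ p * r ^ d) := by
          rw [Real.div_rpow hgw.le two_pos.le]
          have h1 : (4 * K) ^ d * r ^ d = (2 * δ) ^ d := by
            rw [← mul_pow]; congr 1; simp only [r]; field_simp; ring
          rw [← h1]
          have : (2 : ℝ) ^ p ≠ 0 := (Real.rpow_pos_of_pos two_pos p).ne'
          field_simp
  calc ‖g 0‖ₑ ^ p = ENNReal.ofReal (‖g 0‖ ^ p) := by
        rw [← ENNReal.ofReal_rpow_of_nonneg (by positivity) hp.le, ofReal_norm]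
    _ ≤ ENNReal.ofReal (2 ^ p * (4 * K) ^ d * ((‖g w‖ / 2) ^ p * r ^ d)) :=
        ENNReal.ofReal_le_ofReal hnum
    _ = ENNReal.ofReal (2 ^ p * (4 * K) ^ d) * V⁻¹ *
        (ENNReal.ofReal ((‖g w‖ / 2) ^ p * r ^ d) * V) := by
        rw [ENNReal.ofReal_mul (by positivity), mul_comm _ V, ← mul_assoc,
          mul_assoc _ V⁻¹ V, ENNReal.inv_mul_cancel hV0 hVt, mul_one]
    _ ≤ _ := by gcongr

/-- Translating to `w` and multiplying by a holomorphic exponential absorbs the weight up to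
`exp(α|u|²/2)`, bounded on the unit ball, so the unweighted inequality applies with a constant
independent of `w`. -/
theorem exists_weighted_enorm_rpow_le (n : ℕ) {α p : ℝ} (hα : 0 < α) (hp : 0 < p) :
    ∃ C : ℝ≥0∞, C ≠ ∞ ∧ ∀ f : EuclideanSpace ℂ (Fin n) → ℂ, Differentiable ℂ f → ∀ w,
      ‖f w * (Real.exp (-α * ‖w‖ ^ 2 / 2) : ℂ)‖ₑ ^ p ≤
        C * ∫⁻ v in Metric.ball w 1, ‖f v * (Real.exp (-α * ‖v‖ ^ 2 / 2) : ℂ)‖ₑ ^ p := by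
  obtain ⟨C, hC, h⟩ := exists_enorm_rpow_le_lintegral_ball
    (volume : Measure (EuclideanSpace ℂ (Fin n))) hp
  refine ⟨C * ENNReal.ofReal (Real.exp (α / 2)) ^ p, by finiteness, fun f hf w => ?_⟩
  have hc := hf.continuous
  let g : EuclideanSpace ℂ (Fin n) → ℂ := fun u =>
    f (w + u) * Complex.exp (-α * innerSL ℂ w u + (-α * ‖w‖ ^ 2 / 2 : ℝ))
  have hg : Differentiable ℂ g := by fun_prop
  have hgn : ∀ u, ‖g u‖ = ‖f (w + u) * (Real.exp (-α * ‖w + u‖ ^ 2 / 2) : ℂ)‖ *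
      Real.exp (α * ‖u‖ ^ 2 / 2) := by
    intro u
    rw [norm_mul, norm_mul, Complex.norm_exp, Complex.norm_real, Real.norm_eq_abs, Real.abs_exp,
      mul_assoc, ← Real.exp_add]
    have h1 : ‖w + u‖ ^ 2 = ‖w‖ ^ 2 + 2 * (innerSL ℂ w u).re + ‖u‖ ^ 2 := by
      simpa using norm_add_sq (𝕜 := ℂ) w u
    have h2 : (-(α : ℂ) * innerSL ℂ w u + (-α * ‖w‖ ^ 2 / 2 : ℝ)).re =
        -α * (innerSL ℂ w u).re + -α * ‖w‖ ^ 2 / 2 := by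
      rw [Complex.add_re, Complex.ofReal_re, ← Complex.ofReal_neg, Complex.re_ofReal_mul]
    rw [h2, h1]
    congr 2
    ring
  have hg0 : ‖g 0‖ₑ = ‖f w * (Real.exp (-α * ‖w‖ ^ 2 / 2) : ℂ)‖ₑ := by
    rw [← ofReal_norm, hgn, ← ofReal_norm]; simp
  rw [← hg0]
  refine (h g hg).trans ?_
  rw [mul_assoc]
  gcongr
  have hm : Measurable fun v => ‖f v * (Real.exp (-α * ‖v‖ ^ 2 / 2) : ℂ)‖ₑ ^ p :=
    (Continuous.enorm (by fun_prop)).measurable.pow_const p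
  have htr := (measurePreserving_add_left (volume : Measure (EuclideanSpace ℂ (Fin n)))
    w).setLIntegral_comp_preimage (s := Metric.ball w 1) measurableSet_ball hm
  rw [← htr, ← lintegral_const_mul']
  · have hpre : (fun u => w + u) ⁻¹' Metric.ball w 1 = Metric.ball 0 1 := by
      ext u; simp [dist_eq_norm]
    rw [hpre]
    refine setLIntegral_mono' measurableSet_ball fun u hu => ?_
    rw [← ENNReal.mul_rpow_of_nonneg _ _ hp.le]
    gcongr
    rw [← ofReal_norm, hgn, ← ofReal_norm, ← ENNReal.ofReal_mul (by positivity), mul_comm]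
    gcongr
    have hu1 : ‖u‖ < 1 := by simpa using hu
    have : ‖u‖ ^ 2 ≤ 1 := pow_le_one₀ (norm_nonneg _) hu1.le
    nlinarith
  · finiteness

/-! ### Part (a) -/

theorem norm_radialDeriv_weighted {n : ℕ} (f : EuclideanSpace ℂ (Fin n) → ℂ) (α : ℝ)
    (z : EuclideanSpace ℂ (Fin n)) :
    ‖radialDeriv f z / (1 + (‖z‖ : ℂ) ^ 2) * (Real.exp (-α * ‖z‖ ^ 2 / 2) : ℂ)‖ =
      ‖radialDeriv f z‖ / (1 + ‖z‖ ^ 2) * Real.exp (-α * ‖z‖ ^ 2 / 2) := by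
  have h : (1 + (‖z‖ : ℂ) ^ 2) = ((1 + ‖z‖ ^ 2 : ℝ) : ℂ) := by push_cast; rfl
  rw [h, norm_mul, norm_div, Complex.norm_real, Complex.norm_real, Real.norm_of_nonneg (by positivity),
    Real.norm_of_nonneg (by positivity)]

theorem continuous_radialDeriv_weighted {n : ℕ} {f : EuclideanSpace ℂ (Fin n) → ℂ}
    (hf : Differentiable ℂ f) (α : ℝ) :
    Continuous fun z => radialDeriv f z / (1 + (‖z‖ : ℂ) ^ 2) *
      (Real.exp (-α * ‖z‖ ^ 2 / 2) : ℂ) := by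
  have hc := continuous_radialDeriv hf
  have h : ∀ z : EuclideanSpace ℂ (Fin n), (1 + (‖z‖ : ℂ) ^ 2) ≠ 0 := by
    intro z
    have h1 : (1 + (‖z‖ : ℂ) ^ 2) = ((1 + ‖z‖ ^ 2 : ℝ) : ℂ) := by push_cast; rfl
    rw [h1, Complex.ofReal_ne_zero]
    positivity
  fun_prop (disch := exact h _)

/-- A closed set of full measure is dense, hence everything. -/
theorem Continuous.norm_le_of_memLp_top {X F : Type*} [TopologicalSpace X] [MeasurableSpace X]
    {μ : Measure X} [μ.IsOpenPosMeasure] [NormedAddCommGroup F] {g : X → F} (hg : Continuous g)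
    (h : MemLp g ∞ μ) : ∃ C : ℝ, ∀ x, ‖g x‖ ≤ C := by
  refine ⟨(eLpNorm g ∞ μ).toReal, ?_⟩
  have h1 : ∀ᵐ x ∂μ, ‖g x‖ ≤ (eLpNorm g ∞ μ).toReal := by
    filter_upwards [ae_le_eLpNormEssSup (f := g) (μ := μ)] with x hx
    rw [← toReal_enorm]
    exact ENNReal.toReal_mono h.2.ne (by rwa [eLpNorm_exponent_top])
  have hd := Measure.dense_of_ae h1
  have hcl : IsClosed {x | ‖g x‖ ≤ (eLpNorm g ∞ μ).toReal} := isClosed_le hg.norm continuous_const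
  intro x
  have hx := hd x
  rwa [hcl.closure_eq] at hx

theorem radialDeriv_mem_weightedLp {n : ℕ} {f : EuclideanSpace ℂ (Fin n) → ℂ}
    {α : ℝ} (hα : 0 < α) {p : ℝ≥0∞} (hp : 0 < p) (hf : f ∈ fockSpace n α p) :
    (fun z => radialDeriv f z / (1 + (‖z‖ : ℂ) ^ 2)) ∈ weightedLp n α p := by
  obtain ⟨hfL, hfd : Differentiable ℂ f⟩ := hf
  have hfL : MemLp (fun z => f z * (Real.exp (-α * ‖z‖ ^ 2 / 2) : ℂ)) p volume := hfL
  have hfc := hfd.continuous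
  have hc : Continuous fun z => f z * (Real.exp (-α * ‖z‖ ^ 2 / 2) : ℂ) := by fun_prop
  have hRc := continuous_radialDeriv_weighted hfd α
  set D := 2 * Real.exp (3 * α / 2)
  have hbd : ∀ z, ∃ w, ‖w - z‖ ≤ 1 ∧
      ‖radialDeriv f z / (1 + (‖z‖ : ℂ) ^ 2) * (Real.exp (-α * ‖z‖ ^ 2 / 2) : ℂ)‖ ≤
        D * ‖f w * (Real.exp (-α * ‖w‖ ^ 2 / 2) : ℂ)‖ := by
    intro z
    obtain ⟨w, hw, h⟩ := exists_radialDeriv_le hfd hα z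
    refine ⟨w, hw, ?_⟩
    rwa [norm_radialDeriv_weighted, norm_mul, Complex.norm_real, Real.norm_of_nonneg (by positivity)]
  change MemLp _ p volume
  by_cases hpt : p = ∞
  · subst hpt
    obtain ⟨C, hC⟩ := hc.norm_le_of_memLp_top hfL
    refine memLp_top_of_bound hRc.aestronglyMeasurable (D * C) (Filter.Eventually.of_forall ?_)
    intro z
    obtain ⟨w, -, h⟩ := hbd z
    exact h.trans (mul_le_mul_of_nonneg_left (hC w) (by positivity))
  · have hq : 0 < p.toReal := ENNReal.toReal_pos hp.ne' hpt
    refine ⟨hRc.aestronglyMeasurable, ?_⟩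
    have hfin := (eLpNorm_lt_top_iff_lintegral_rpow_enorm_lt_top hp.ne' hpt).1 hfL.2
    rw [eLpNorm_lt_top_iff_lintegral_rpow_enorm_lt_top hp.ne' hpt]
    set q := p.toReal
    obtain ⟨C, hC, hsub⟩ := exists_weighted_enorm_rpow_le n hα hq
    set F : EuclideanSpace ℂ (Fin n) → ℝ≥0∞ :=
      fun v => ‖f v * (Real.exp (-α * ‖v‖ ^ 2 / 2) : ℂ)‖ₑ ^ q
    have hF : Measurable F := hc.enorm.measurable.pow_const q
    set B : Set (EuclideanSpace ℂ (Fin n)) := Metric.ball 0 2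
    have hpt : ∀ z, ‖radialDeriv f z / (1 + (‖z‖ : ℂ) ^ 2) *
        (Real.exp (-α * ‖z‖ ^ 2 / 2) : ℂ)‖ₑ ^ q ≤
          ENNReal.ofReal D ^ q * C * ∫⁻ u in B, F (z + u) := by
      intro z
      obtain ⟨w, hw, h⟩ := hbd z
      have htr := (measurePreserving_add_left (volume : Measure (EuclideanSpace ℂ (Fin n)))
        z).setLIntegral_comp_preimage (s := Metric.ball z 2) measurableSet_ball hF
      have hpre : (fun u => z + u) ⁻¹' Metric.ball z 2 = B := by
        ext u; simp [B, dist_eq_norm]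
      rw [hpre] at htr
      calc _ ≤ (ENNReal.ofReal D * ‖f w * (Real.exp (-α * ‖w‖ ^ 2 / 2) : ℂ)‖ₑ) ^ q := by
            gcongr
            rw [← ofReal_norm, ← ofReal_norm, ← ENNReal.ofReal_mul (by positivity)]
            exact ENNReal.ofReal_le_ofReal h
        _ = ENNReal.ofReal D ^ q * F w := ENNReal.mul_rpow_of_nonneg _ _ hq.le
        _ ≤ ENNReal.ofReal D ^ q * (C * ∫⁻ v in Metric.ball w 1, F v) := by
            gcongr; exact hsub f hfd w
        _ ≤ ENNReal.ofReal D ^ q * (C * ∫⁻ v in Metric.ball z 2, F v) := by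
            gcongr
            refine Metric.ball_subset_ball' ?_
            rw [dist_eq_norm]; linarith
        _ = _ := by rw [htr, mul_assoc]
    -- Centring the ball at the origin makes its domain independent of `z`, so Tonelli and
    -- translation invariance apply.
    have hswap : ∫⁻ z, ∫⁻ u in B, F (z + u) = volume B * ∫⁻ z, F z := by
      rw [lintegral_lintegral_swap]
      · simp_rw [lintegral_add_right_eq_self F]
        rw [setLIntegral_const, mul_comm]
      · exact (hF.comp (measurable_fst.add measurable_snd)).aemeasurable
    calc _ ≤ ∫⁻ z, ENNReal.ofReal D ^ q * C * ∫⁻ u in B, F (z + u) := lintegral_mono hpt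
      _ = ENNReal.ofReal D ^ q * C * (volume B * ∫⁻ z, F z) := by
          rw [lintegral_const_mul' _ _ (by finiteness), hswap]
      _ < ∞ := by
          have hK : ENNReal.ofReal D ^ q * C < ∞ := by finiteness
          exact ENNReal.mul_lt_top hK (ENNReal.mul_lt_top measure_ball_lt_top hfin)

/-! ### Part (b) for `p = ∞` -/

theorem hasDerivAt_comp_real_smul {n : ℕ} {f : EuclideanSpace ℂ (Fin n) → ℂ}
    (hf : Differentiable ℂ f) (z : EuclideanSpace ℂ (Fin n)) {t : ℝ} (ht : t ≠ 0) :
    HasDerivAt (fun t : ℝ => f (t • z)) (radialDeriv f (t • z) / t) t := by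
  have h1 : HasDerivAt (fun t : ℝ => t • z) ((1 : ℝ) • z) t := (hasDerivAt_id t).smul_const z
  have h2 := ((hf (t • z)).hasFDerivAt.restrictScalars ℝ).comp_hasDerivAt t h1
  convert! h2 using 1
  have ht' : (t : ℂ) ≠ 0 := by exact_mod_cast ht
  rw [radialDeriv_eq_fderiv (hf _), one_smul, ContinuousLinearMap.coe_restrictScalars']
  have h3 : (t • z) = (t : ℂ) • z := by simp
  nth_rewrite 2 [h3]
  rw [map_smul, smul_eq_mul, mul_div_cancel_left₀ _ ht']

theorem mem_weightedLp_top_of_radialDeriv {n : ℕ} {f : EuclideanSpace ℂ (Fin n) → ℂ}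
    (hf : Differentiable ℂ f) {α : ℝ} (hα : 0 < α)
    (h : (fun z => radialDeriv f z / (1 + (‖z‖ : ℂ) ^ 2)) ∈ weightedLp n α ∞) :
    f ∈ weightedLp n α ∞ := by
  have hfc := hf.continuous
  obtain ⟨C, hC⟩ := (continuous_radialDeriv_weighted hf α).norm_le_of_memLp_top h
  have hC0 : 0 ≤ C := (norm_nonneg _).trans (hC 0)
  have hR : ∀ w, ‖radialDeriv f w‖ ≤ C * (1 + ‖w‖ ^ 2) * Real.exp (α * ‖w‖ ^ 2 / 2) := by
    intro w
    have h1 := hC w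
    rw [norm_radialDeriv_weighted, div_mul_eq_mul_div, div_le_iff₀ (by positivity)] at h1
    calc _ = ‖radialDeriv f w‖ * Real.exp (-α * ‖w‖ ^ 2 / 2) * Real.exp (α * ‖w‖ ^ 2 / 2) := by
          rw [mul_assoc, ← Real.exp_add]; ring_nf; simp
      _ ≤ _ := by gcongr
  obtain ⟨M, hM⟩ := (isCompact_closedBall (0 : EuclideanSpace ℂ (Fin n))
    1).exists_bound_of_continuousOn hfc.continuousOn
  have hM0 : 0 ≤ M := (norm_nonneg _).trans (hM 0 (by simp))
  have hbd : ∀ z, ‖f z‖ ≤ M + 2 * C / α * Real.exp (α * ‖z‖ ^ 2 / 2) := by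
    intro z
    rcases le_total ‖z‖ 1 with hz | hz
    · have := hM z (by simpa using hz)
      have : 0 ≤ 2 * C / α * Real.exp (α * ‖z‖ ^ 2 / 2) := by positivity
      linarith
    have hz0 : 0 < ‖z‖ := by linarith
    have ha : ‖z‖⁻¹ ≤ 1 := inv_le_one_of_one_le₀ hz
    have hapos : 0 < ‖z‖⁻¹ := by positivity
    -- The ray starts on the unit sphere, so `1 ≤ t‖z‖` throughout and `1 + (t‖z‖)² ≤ 2(t‖z‖)²`;
    -- this is the 2 in `B'`.
    have key := image_norm_le_of_norm_deriv_right_le_deriv_boundary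
      (f := fun t : ℝ => f (t • z)) (a := ‖z‖⁻¹) (b := 1)
      (f' := fun t => radialDeriv f (t • z) / t)
      (B := fun t => M + 2 * C / α * Real.exp (α * (t * ‖z‖) ^ 2 / 2))
      (B' := fun t => 2 * C * t * ‖z‖ ^ 2 * Real.exp (α * (t * ‖z‖) ^ 2 / 2))
      (by fun_prop)
      (fun t ht => (hasDerivAt_comp_real_smul hf z (hapos.trans_le ht.1).ne').hasDerivWithinAt)
      ?_ ?_ ?_ (Set.right_mem_Icc.2 ha)
    · simpa using key
    · have h1 := hM (‖z‖⁻¹ • z) (by simp [norm_smul, hz0.ne'])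
      have : 0 ≤ 2 * C / α * Real.exp (α * (‖z‖⁻¹ * ‖z‖) ^ 2 / 2) := by positivity
      linarith
    · intro t
      have h1 : HasDerivAt (fun t : ℝ => α * (t * ‖z‖) ^ 2 / 2) (α * t * ‖z‖ ^ 2) t := by
        have := ((((hasDerivAt_id t).mul_const ‖z‖).pow 2).const_mul α).div_const 2
        convert! this using 1
        simp; ring
      convert! (h1.exp.const_mul (2 * C / α)).const_add M using 1
      field_simp
    · intro t ht
      have ht0 : 0 < t := hapos.trans_le ht.1
      have h1 := hR (t • z)
      have h2 : ‖t • z‖ = t * ‖z‖ := by rw [norm_smul, Real.norm_of_nonneg ht0.le]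
      rw [h2] at h1
      have h3 : 1 ≤ t * ‖z‖ := by
        have := mul_le_mul_of_nonneg_right ht.1 hz0.le
        rwa [inv_mul_cancel₀ hz0.ne'] at this
      rw [norm_div, Complex.norm_real, Real.norm_of_nonneg ht0.le, div_le_iff₀ ht0]
      refine h1.trans ?_
      calc _ ≤ C * (2 * (t * ‖z‖) ^ 2) * Real.exp (α * (t * ‖z‖) ^ 2 / 2) := by
            gcongr; nlinarith
        _ = _ := by ring
  have hc : Continuous fun z => f z * (Real.exp (-α * ‖z‖ ^ 2 / 2) : ℂ) := by fun_prop
  refine memLp_top_of_bound hc.aestronglyMeasurable (M + 2 * C / α)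
    (Filter.Eventually.of_forall fun z => ?_)
  rw [norm_mul, Complex.norm_real, Real.norm_of_nonneg (by positivity)]
  have h1 : Real.exp (-α * ‖z‖ ^ 2 / 2) ≤ 1 := by
    apply Real.exp_le_one_iff.2
    nlinarith [sq_nonneg ‖z‖, mul_nonneg hα.le (sq_nonneg ‖z‖)]
  calc _ ≤ (M + 2 * C / α * Real.exp (α * ‖z‖ ^ 2 / 2)) * Real.exp (-α * ‖z‖ ^ 2 / 2) := by
        gcongr; exact hbd z
    _ = M * Real.exp (-α * ‖z‖ ^ 2 / 2) + 2 * C / α := by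
        rw [add_mul, mul_assoc (2 * C / α), ← Real.exp_add]; ring_nf; simp
    _ ≤ M * 1 + 2 * C / α := by gcongr
    _ = _ := by ring

/-! ### Part (b) for `p = 1` -/

/-- The fundamental theorem of calculus along the ray, with `s = 1/t`; the cutoff allows the fixed
domain `s > 1`, as needed for Tonelli. -/
theorem enorm_le_add_lintegral_radialDeriv {n : ℕ} {f : EuclideanSpace ℂ (Fin n) → ℂ}
    (hf : Differentiable ℂ f) {r M : ℝ} (hr : 0 < r) (hM : ∀ w, ‖w‖ ≤ r → ‖f w‖ ≤ M)
    (z : EuclideanSpace ℂ (Fin n)) :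
    ‖f z‖ₑ ≤ ENNReal.ofReal M + ∫⁻ s in Set.Ioi (1 : ℝ),
      {w | r ≤ ‖w‖}.indicator (fun w => ‖radialDeriv f w‖ₑ) (s⁻¹ • z) * ENNReal.ofReal s⁻¹ := by
  rcases le_total ‖z‖ r with hz | hz
  · refine le_add_right ?_
    rw [← ofReal_norm]
    exact ENNReal.ofReal_le_ofReal (hM z hz)
  have hz0 : 0 < ‖z‖ := hr.trans_le hz
  -- The parameter at which `s⁻¹ • z` reaches the sphere of radius `r`.
  set S := ‖z‖ / r
  have hS : 1 ≤ S := (one_le_div hr).2 hz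
  have hderiv : ∀ s ∈ Set.uIcc 1 S, HasDerivAt (fun s : ℝ => f (s⁻¹ • z))
      (-(radialDeriv f (s⁻¹ • z) * (s⁻¹ : ℝ))) s := by
    intro s hs
    rw [Set.uIcc_of_le hS] at hs
    have hs0 : 0 < s := one_pos.trans_le hs.1
    have h1 := (hasDerivAt_comp_real_smul hf z (inv_ne_zero hs0.ne')).scomp s
      (hasDerivAt_inv hs0.ne')
    convert! h1 using 1
    have : (s : ℂ) ≠ 0 := by exact_mod_cast hs0.ne'
    simp only [Complex.real_smul]
    push_cast
    field_simp
  have hRc := continuous_radialDeriv hf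
  have hcont : ContinuousOn (fun s : ℝ => -(radialDeriv f (s⁻¹ • z) * (s⁻¹ : ℝ)))
      (Set.uIcc 1 S) := by
    rw [Set.uIcc_of_le hS]
    have hinv : ContinuousOn (fun s : ℝ => s⁻¹) (Set.Icc 1 S) :=
      continuousOn_inv₀.mono fun s hs => (one_pos.trans_le hs.1).ne'
    refine ((hRc.comp_continuousOn (hinv.smul continuousOn_const)).mul ?_).neg
    exact Complex.continuous_ofReal.comp_continuousOn hinv
  have hFTC := intervalIntegral.integral_eq_sub_of_hasDerivAt hderiv hcont.intervalIntegrable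
  have hfz : f z = f (S⁻¹ • z) - ∫ s in (1 : ℝ)..S, -(radialDeriv f (s⁻¹ • z) * (s⁻¹ : ℝ)) := by
    rw [hFTC]; simp
  have hSz : ‖S⁻¹ • z‖ ≤ r := by
    rw [norm_smul, Real.norm_of_nonneg (by positivity)]
    simp only [S, inv_div]
    rw [div_mul_cancel₀ _ hz0.ne']
  rw [hfz]
  refine (enorm_sub_le).trans (add_le_add ?_ ?_)
  · rw [← ofReal_norm]
    exact ENNReal.ofReal_le_ofReal (hM _ hSz)
  · rw [intervalIntegral.integral_of_le hS]
    refine (enorm_integral_le_lintegral_enorm _).trans ?_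
    refine le_trans (setLIntegral_mono' measurableSet_Ioc fun s hs => ?_)
      (lintegral_mono_set fun _ hs => hs.1)
    have hs0 : 0 < s := one_pos.trans hs.1
    have hmem : s⁻¹ • z ∈ {w : EuclideanSpace ℂ (Fin n) | r ≤ ‖w‖} := by
      change r ≤ ‖s⁻¹ • z‖
      rw [norm_smul, Real.norm_of_nonneg (by positivity), inv_mul_eq_div, le_div_iff₀ hs0, mul_comm,
        ← le_div_iff₀ hr]
      exact hs.2
    rw [Set.indicator_of_mem hmem, enorm_neg, enorm_mul]
    gcongr
    rw [← ofReal_norm, Complex.norm_real, Real.norm_of_nonneg (by positivity)]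

theorem lintegral_comp_inv_smul {E : Type*} [NormedAddCommGroup E] [NormedSpace ℝ E]
    [MeasurableSpace E] [BorelSpace E] [FiniteDimensional ℝ E] (μ : Measure E)
    [μ.IsAddHaarMeasure] {g : E → ℝ≥0∞} (hg : Measurable g) {s : ℝ} (hs : 0 < s) :
    ∫⁻ z, g (s⁻¹ • z) ∂μ = ENNReal.ofReal (s ^ Module.finrank ℝ E) * ∫⁻ w, g w ∂μ := by
  rw [← lintegral_map hg (measurable_const_smul s⁻¹),
    Measure.map_addHaar_smul μ (inv_ne_zero hs.ne'), lintegral_smul_measure, inv_pow, inv_inv,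
    abs_of_pos (by positivity), smul_eq_mul]

/-- From `s ≤ exp(s² - 1)` and `d ≤ b/2`, the power `s^d` costs only half of the Gaussian decay;
with `s⁻¹ ≤ s` the majorant has an explicit primitive. -/
theorem lintegral_pow_mul_gaussian_le (d : ℕ) {b : ℝ} (hb : 0 < b) (hd : (d : ℝ) ≤ b / 2) :
    ∫⁻ s in Set.Ioi (1 : ℝ), ENNReal.ofReal (s ^ d * s⁻¹ * Real.exp (-b * s ^ 2)) ≤
      ENNReal.ofReal (1 / b * Real.exp (-b)) := by
  have hd1 : ∀ s ∈ Set.Ici (1 : ℝ), HasDerivAt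
      (fun s => -(1 / b) * Real.exp (-b / 2 - b / 2 * s ^ 2))
      (s * Real.exp (-b / 2 - b / 2 * s ^ 2)) s := by
    intro s _
    have h1 : HasDerivAt (fun s : ℝ => -b / 2 - b / 2 * s ^ 2) (-b * s) s := by
      have := ((hasDerivAt_pow 2 s).const_mul (b / 2)).const_sub (-b / 2)
      convert! this using 1
      simp; ring
    convert! h1.exp.const_mul (-(1 / b)) using 1
    field_simp
  have hnn : ∀ s ∈ Set.Ioi (1 : ℝ), 0 ≤ s * Real.exp (-b / 2 - b / 2 * s ^ 2) := by
    intro s hs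
    have : 0 < s := one_pos.trans hs
    positivity
  have hlim : Filter.Tendsto (fun s : ℝ => -(1 / b) * Real.exp (-b / 2 - b / 2 * s ^ 2))
      Filter.atTop (nhds (-(1 / b) * 0)) := by
    refine Filter.Tendsto.const_mul _ (Real.tendsto_exp_atBot.comp ?_)
    simp only [sub_eq_add_neg]
    refine Filter.tendsto_atBot_add_const_left _ _ (Filter.tendsto_neg_atTop_atBot.comp ?_)
    exact (Filter.tendsto_pow_atTop two_ne_zero).const_mul_atTop (by positivity)
  have hint := integrableOn_Ioi_deriv_of_nonneg' hd1 hnn hlim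
  have hval := integral_Ioi_of_hasDerivAt_of_nonneg' hd1 hnn hlim
  have hle : ∀ s ∈ Set.Ioi (1 : ℝ), s ^ d * s⁻¹ * Real.exp (-b * s ^ 2) ≤
      s * Real.exp (-b / 2 - b / 2 * s ^ 2) := by
    intro s hs
    have hs1 : 1 < s := hs
    have hs0 : 0 < s := one_pos.trans hs1
    have h1 : s ≤ Real.exp (s ^ 2 - 1) := by
      have := Real.add_one_le_exp (s ^ 2 - 1)
      nlinarith
    have h2 : s ^ d ≤ Real.exp (b / 2 * (s ^ 2 - 1)) := by
      calc s ^ d ≤ Real.exp (s ^ 2 - 1) ^ d := by gcongr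
        _ = Real.exp (d * (s ^ 2 - 1)) := by rw [Real.exp_nat_mul]
        _ ≤ _ := by
          gcongr
          nlinarith
    have h3 : s⁻¹ ≤ s := (inv_le_one_of_one_le₀ hs1.le).trans hs1.le
    calc _ ≤ Real.exp (b / 2 * (s ^ 2 - 1)) * s * Real.exp (-b * s ^ 2) := by gcongr
      _ = s * (Real.exp (b / 2 * (s ^ 2 - 1)) * Real.exp (-b * s ^ 2)) := by ring
      _ = _ := by rw [← Real.exp_add]; ring_nf
  calc _ ≤ ∫⁻ s in Set.Ioi (1 : ℝ), ENNReal.ofReal (s * Real.exp (-b / 2 - b / 2 * s ^ 2)) :=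
        setLIntegral_mono' measurableSet_Ioi fun s hs => ENNReal.ofReal_le_ofReal (hle s hs)
    _ = ENNReal.ofReal (∫ s in Set.Ioi (1 : ℝ), s * Real.exp (-b / 2 - b / 2 * s ^ 2)) :=
        (ofReal_integral_eq_lintegral_ofReal hint
          ((ae_restrict_iff' measurableSet_Ioi).2 (Filter.Eventually.of_forall hnn))).symm
    _ = _ := by rw [hval]; congr 1; ring_nf

theorem mem_weightedLp_one_of_radialDeriv {n : ℕ} {f : EuclideanSpace ℂ (Fin n) → ℂ}
    (hf : Differentiable ℂ f) {α : ℝ} (hα : 0 < α)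
    (h : (fun z => radialDeriv f z / (1 + (‖z‖ : ℂ) ^ 2)) ∈ weightedLp n α 1) :
    f ∈ weightedLp n α 1 := by
  have hfc := hf.continuous
  have hRc := continuous_radialDeriv hf
  have hc : Continuous fun z => f z * (Real.exp (-α * ‖z‖ ^ 2 / 2) : ℂ) := by fun_prop
  set d := Module.finrank ℝ (EuclideanSpace ℂ (Fin n))
  -- Large enough that `b = α‖w‖²/2` satisfies `d ≤ b/2` as soon as `‖w‖ ≥ r`; being at least 1, it
  -- also makes `1/‖w‖²` comparable to `1/(1+‖w‖²)`.
  set r : ℝ := 1 + 4 * d / α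
  have hr1 : 1 ≤ r := by simp only [r]; linarith [show 0 ≤ 4 * d / α by positivity]
  have hr : 0 < r := by linarith
  have hrd : ∀ w : EuclideanSpace ℂ (Fin n), r ≤ ‖w‖ → (d : ℝ) ≤ α * ‖w‖ ^ 2 / 2 / 2 := by
    intro w hw
    have h1 : 4 * d / α ≤ ‖w‖ ^ 2 := by
      have : 4 * d / α ≤ r := by simp only [r]; linarith
      nlinarith
    rw [div_le_iff₀ hα] at h1
    linarith
  obtain ⟨M, hM⟩ := (isCompact_closedBall (0 : EuclideanSpace ℂ (Fin n))
    r).exists_bound_of_continuousOn hfc.continuousOn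
  set Q : EuclideanSpace ℂ (Fin n) → ℝ≥0∞ :=
    {w | r ≤ ‖w‖}.indicator fun w => ‖radialDeriv f w‖ₑ
  have hQ : Measurable Q := hRc.enorm.measurable.indicator
    (isClosed_le continuous_const continuous_norm).measurableSet
  set γ : ℝ → ℝ≥0∞ := fun x => ENNReal.ofReal (Real.exp (-α * x ^ 2 / 2))
  have hγ : Measurable γ := by fun_prop
  have hptw : ∀ z, ‖f z * (Real.exp (-α * ‖z‖ ^ 2 / 2) : ℂ)‖ₑ ≤
      ENNReal.ofReal M * γ ‖z‖ +
        ∫⁻ s in Set.Ioi (1 : ℝ), Q (s⁻¹ • z) * ENNReal.ofReal s⁻¹ * γ ‖z‖ := by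
    intro z
    have h1 : ‖(Real.exp (-α * ‖z‖ ^ 2 / 2) : ℂ)‖ₑ = γ ‖z‖ := by
      rw [← ofReal_norm, Complex.norm_real, Real.norm_of_nonneg (by positivity)]
    rw [enorm_mul, h1, lintegral_mul_const' _ _ (by finiteness), ← add_mul]
    gcongr
    exact enorm_le_add_lintegral_radialDeriv hf hr (fun w hw => hM w (by simpa using hw)) z
  have hgauss : ∫⁻ z : EuclideanSpace ℂ (Fin n), γ ‖z‖ < ∞ := by
    have h1 := (GaussianFourier.integrable_cexp_neg_mul_sq_norm_add
      (V := EuclideanSpace ℂ (Fin n)) (b := (α / 2 : ℝ)) (by simpa using hα) 0 0).2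
    rw [hasFiniteIntegral_iff_enorm] at h1
    refine lt_of_eq_of_lt (lintegral_congr fun z => ?_) h1
    rw [← ofReal_norm, Complex.norm_exp]
    simp only [γ]
    congr 2
    rw [zero_mul, add_zero, ← Complex.ofReal_pow, ← Complex.ofReal_neg, ← Complex.ofReal_mul,
      Complex.ofReal_re]
    ring
  have hinner : ∀ w, Q w * ∫⁻ s in Set.Ioi (1 : ℝ),
      ENNReal.ofReal (s ^ d * s⁻¹) * γ (s * ‖w‖) ≤ ENNReal.ofReal (4 / α) *
        ‖radialDeriv f w / (1 + (‖w‖ : ℂ) ^ 2) * (Real.exp (-α * ‖w‖ ^ 2 / 2) : ℂ)‖ₑ := by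
    intro w
    by_cases hw : r ≤ ‖w‖
    · have hQw : Q w = ‖radialDeriv f w‖ₑ := Set.indicator_of_mem (s := {w | r ≤ ‖w‖}) hw _
      have hw1 : 1 ≤ ‖w‖ := hr1.trans hw
      have hw0 : 0 < ‖w‖ := by linarith
      have hI := lintegral_pow_mul_gaussian_le d (b := α * ‖w‖ ^ 2 / 2) (by positivity) (hrd w hw)
      have hI' : ∫⁻ s in Set.Ioi (1 : ℝ), ENNReal.ofReal (s ^ d * s⁻¹) * γ (s * ‖w‖) ≤
          ENNReal.ofReal (1 / (α * ‖w‖ ^ 2 / 2) * Real.exp (-(α * ‖w‖ ^ 2 / 2))) := by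
        refine le_trans (le_of_eq ?_) hI
        refine setLIntegral_congr_fun measurableSet_Ioi fun s hs => ?_
        have hs0 : (0 : ℝ) < s := one_pos.trans hs
        simp only [γ]
        rw [← ENNReal.ofReal_mul (by positivity)]
        ring_nf
      rw [hQw, ← ofReal_norm, ← ofReal_norm, norm_radialDeriv_weighted,
        ← ENNReal.ofReal_mul (by positivity)]
      refine (mul_le_mul_right hI' _).trans ?_
      rw [← ENNReal.ofReal_mul (by positivity)]
      apply ENNReal.ofReal_le_ofReal
      have h1 : 1 / (α * ‖w‖ ^ 2 / 2) ≤ 4 / α * (1 / (1 + ‖w‖ ^ 2)) := by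
        rw [div_mul_div_comm, div_le_div_iff₀ (by positivity) (by positivity)]
        have : α * 1 ≤ α * ‖w‖ ^ 2 := by gcongr; exact one_le_pow₀ hw1
        linarith
      have h2 : -(α * ‖w‖ ^ 2 / 2) = -α * ‖w‖ ^ 2 / 2 := by ring
      rw [h2]
      calc _ ≤ ‖radialDeriv f w‖ * (4 / α * (1 / (1 + ‖w‖ ^ 2)) *
            Real.exp (-α * ‖w‖ ^ 2 / 2)) := by gcongr
        _ = _ := by ring
    · have hQw : Q w = 0 := Set.indicator_of_notMem (s := {w | r ≤ ‖w‖}) hw _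
      simp [hQw]
  have hmeas : Measurable (Function.uncurry fun (z : EuclideanSpace ℂ (Fin n)) (s : ℝ) =>
      Q (s⁻¹ • z) * ENNReal.ofReal s⁻¹ * γ ‖z‖) := by
    refine ((hQ.comp (measurable_snd.inv.smul measurable_fst)).mul ?_).mul ?_
    · exact measurable_snd.inv.ennreal_ofReal
    · exact hγ.comp measurable_fst.norm
  have hmeas' : Measurable (Function.uncurry fun (s : ℝ) (w : EuclideanSpace ℂ (Fin n)) =>
      Q w * (ENNReal.ofReal (s ^ d * s⁻¹) * γ (s * ‖w‖))) := by
    have h1 : Measurable fun x : ℝ × EuclideanSpace ℂ (Fin n) =>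
        ENNReal.ofReal (x.1 ^ d * x.1⁻¹) :=
      ((measurable_fst.pow_const d).mul measurable_fst.inv).ennreal_ofReal
    have h2 : Measurable fun x : ℝ × EuclideanSpace ℂ (Fin n) => γ (x.1 * ‖x.2‖) :=
      hγ.comp (measurable_fst.mul measurable_snd.norm)
    exact (hQ.comp measurable_snd).mul (h1.mul h2)
  -- The substitution `z = s w` has real Jacobian `s^d` and turns the weight at `z` into a Gaussian
  -- in `s`.
  have hdil : ∀ s ∈ Set.Ioi (1 : ℝ),
      ∫⁻ z, Q (s⁻¹ • z) * ENNReal.ofReal s⁻¹ * γ ‖z‖ =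
        ∫⁻ w, Q w * (ENNReal.ofReal (s ^ d * s⁻¹) * γ (s * ‖w‖)) := by
    intro s hs
    have hs0 : (0 : ℝ) < s := one_pos.trans hs
    have hms : Measurable fun w => Q w * ENNReal.ofReal s⁻¹ * γ (s * ‖w‖) :=
      (hQ.mul_const _).mul (hγ.comp (measurable_norm.const_mul s))
    have h1 := lintegral_comp_inv_smul volume hms hs0
    rw [← lintegral_const_mul' _ _ (by finiteness)] at h1
    convert! h1 using 1
    · refine lintegral_congr fun z => ?_
      rw [norm_smul, Real.norm_of_nonneg (by positivity), mul_inv_cancel_left₀ hs0.ne']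
    · refine lintegral_congr fun w => ?_
      rw [ENNReal.ofReal_mul (by positivity)]
      ring
  change MemLp _ 1 volume
  refine ⟨hc.aestronglyMeasurable, ?_⟩
  have hfin : eLpNorm _ 1 volume < ∞ := h.2
  rw [eLpNorm_one_eq_lintegral_enorm] at hfin ⊢
  refine (lintegral_mono hptw).trans_lt ?_
  have hγn : Measurable fun z : EuclideanSpace ℂ (Fin n) => γ ‖z‖ := hγ.comp measurable_norm
  rw [lintegral_add_left (hγn.const_mul _),
    lintegral_const_mul' _ _ (by finiteness)]
  refine ENNReal.add_lt_top.2 ⟨ENNReal.mul_lt_top (by finiteness) hgauss, ?_⟩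
  calc _ = ∫⁻ s in Set.Ioi (1 : ℝ), ∫⁻ z, Q (s⁻¹ • z) * ENNReal.ofReal s⁻¹ * γ ‖z‖ :=
        lintegral_lintegral_swap hmeas.aemeasurable
    _ = ∫⁻ s in Set.Ioi (1 : ℝ), ∫⁻ w, Q w * (ENNReal.ofReal (s ^ d * s⁻¹) * γ (s * ‖w‖)) :=
        setLIntegral_congr_fun measurableSet_Ioi hdil
    _ = ∫⁻ w, ∫⁻ s in Set.Ioi (1 : ℝ), Q w * (ENNReal.ofReal (s ^ d * s⁻¹) * γ (s * ‖w‖)) :=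
        lintegral_lintegral_swap hmeas'.aemeasurable
    _ ≤ ∫⁻ w, ENNReal.ofReal (4 / α) *
        ‖radialDeriv f w / (1 + (‖w‖ : ℂ) ^ 2) * (Real.exp (-α * ‖w‖ ^ 2 / 2) : ℂ)‖ₑ := by
        refine lintegral_mono fun w => ?_
        refine le_trans (le_of_eq ?_) (hinner w)
        refine lintegral_const_mul' _ _ ?_
        by_cases hw : r ≤ ‖w‖ <;> simp [Q, hw]
    _ < ∞ := by
        rw [lintegral_const_mul' _ _ (by finiteness)]
        exact ENNReal.mul_lt_top (by finiteness) hfin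

theorem corollary12 (n : ℕ) (f : EuclideanSpace ℂ (Fin n) → ℂ) (hf : f ∈ entireFunctions n)
    (α : ℝ) (hα : 0 < α) :
    (∀ p : ℝ≥0∞, 0 < p → f ∈ fockSpace n α p →
      (fun z => radialDeriv f z / (1 + (‖z‖ : ℂ) ^ 2)) ∈ weightedLp n α p) ∧
    (∀ p : ℝ≥0∞, p = 1 ∨ p = ∞ →
      (fun z => radialDeriv f z / (1 + (‖z‖ : ℂ) ^ 2)) ∈ weightedLp n α p →
      f ∈ fockSpace n α p) := by
  refine ⟨fun p hp hfp => radialDeriv_mem_weightedLp hα hp hfp, ?_⟩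
  rintro p (rfl | rfl) h
  · exact ⟨mem_weightedLp_one_of_radialDeriv hf hα h, hf⟩
  · exact ⟨mem_weightedLp_top_of_radialDeriv hf hα h, hf⟩
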